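/- For $\kappa\in\mathbb{R}$, let $M_\kappa^2$ be the complete, simply connected, two-dimensional Riemannian manifold of constant Gaussian curvature $\kappa$, let $d_\kappa$ be its distance function, and let $D_\kappa$ be its diameter, so $D_\kappa=\pi/\sqrt{\kappa}$ if $\kappa>0$ and $D_\kappa=\infty$ if $\kappa\le 0$. For $a,b\in M_\kappa^2$ with $d_\kappa(a,b)<D_\kappa$, let $[a,b]$ denote the unique geodesic segment with endpoints $a$ and $b$. **Lemma.** Let $\kappa\in\mathbb{R}$. Suppose $x,y,z,w,x',y',z',w'\in M_\kappa^2$ are points such that $$d_\kappa(x',y')+d_\kappa(y',z')+d_\kappa(z',w')+d_\kappa(w',x')<2D_\kappa,$$ $$d_\kappa(x,y)=d_\kappa(x',y'),\quad d_\kappa(y,z)=d_\kappa(y',z'),\quad d_\kappa(z,w)=d_\kappa(z',w'),\quad d_\kappa(w,x)=d_\kappa(w',x'),$$ $$d_\kappa(x',z')\le d_\kappa(x,z).$$ If $[x',z']\cap[y',w']\neq\emptyset$, then $d_\kappa(y,w)\le d_\kappa(y',w')$. (By the first inequality and the triangle inequality, $d_\kappa(x',z')<D_\kappa$ and $d_\kappa(y',w')<D_\kappa$,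 so the two segments are well defined.) -/

import Mathlib

/-- The underlying set of the model plane `M_κ²`: the quadric `t² + κ (a² + b²) = 1` in `ℝ³`,
restricted to the sheet `t > 0` when `κ ≤ 0`.

* `κ > 0`: `(t, a, b) ↦ (t, √κ a, √κ b)` identifies it with the unit sphere in `ℝ³`;
* `κ = 0`: it is the plane `t = 1`, i.e. the Euclidean plane with coordinates `(a, b)`;
* `κ < 0`: `(t, a, b) ↦ (t, √(-κ) a, √(-κ) b)` identifies it with the upper sheet of the
  hyperboloid `t² - a² - b² = 1`. -/
@[ext]
structure ModelPlane (κ : ℝ) where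
  t : ℝ
  a : ℝ
  b : ℝ
  quadric : t ^ 2 + κ * (a ^ 2 + b ^ 2) = 1
  sheet : κ ≤ 0 → 0 < t

namespace ModelPlane

/-- The polar form of the quadratic form that defines the quadric. Under the identifications
above it is the Euclidean inner product for `κ > 0`, and the negative of the Lorentzian one
for `κ < 0`. -/
def form {κ : ℝ} (u v : ModelPlane κ) : ℝ := u.t * v.t + κ * (u.a * v.a + u.b * v.b)

/-- The distance function `d_κ` of the model plane: for `κ > 0` the angular metric of the unit
sphere divided by `√κ`, for `κ < 0` the metric of the hyperbolic plane (hyperboloid model)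
divided by `√(-κ)`, for `κ = 0` the Euclidean metric. -/
noncomputable def modelDist {κ : ℝ} (u v : ModelPlane κ) : ℝ :=
  if 0 < κ then Real.arccos (form u v) / √κ
  else if κ < 0 then Real.arcosh (form u v) / √(-κ)
  else √((u.a - v.a) ^ 2 + (u.b - v.b) ^ 2)

theorem form_self {κ : ℝ} (u : ModelPlane κ) : form u u = 1 := by
  have := u.quadric
  unfold form
  linear_combination this

theorem form_comm {κ : ℝ} (u v : ModelPlane κ) : form u v = form v u := by
  unfold form
  ring

theorem form_gram {κ : ℝ} (u v w : ModelPlane κ) :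
    (form u w - form u v * form v w) ^ 2 ≤ (1 - form u v ^ 2) * (1 - form v w ^ 2) := by
  have h : form u u * form v v * form w w + 2 * form u v * form v w * form u w
      - form u u * form v w ^ 2 - form v v * form u w ^ 2 - form w w * form u v ^ 2
      = (κ * (u.t * (v.a * w.b - v.b * w.a) - u.a * (v.t * w.b - v.b * w.t)
        + u.b * (v.t * w.a - v.a * w.t))) ^ 2 := by
    unfold form
    ring
  rw [form_self, form_self, form_self] at h
  nlinarith [sq_nonneg (κ * (u.t * (v.a * w.b - v.b * w.a) - u.a * (v.t * w.b - v.b * w.t)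
        + u.b * (v.t * w.a - v.a * w.t)))]

theorem form_sq_le_one {κ : ℝ} (hκ : 0 < κ) (u v : ModelPlane κ) : form u v ^ 2 ≤ 1 := by
  have h : form u u * form v v - form u v ^ 2
      = κ * ((u.t * v.a - v.t * u.a) ^ 2 + (u.t * v.b - v.t * u.b) ^ 2)
        + (κ * (u.a * v.b - v.a * u.b)) ^ 2 := by
    unfold form
    ring
  rw [form_self, form_self] at h
  have : 0 ≤ κ * ((u.t * v.a - v.t * u.a) ^ 2 + (u.t * v.b - v.t * u.b) ^ 2) := by positivity
  nlinarith [sq_nonneg (κ * (u.a * v.b - v.a * u.b))]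

theorem one_le_form {κ : ℝ} (hκ : κ < 0) (u v : ModelPlane κ) : 1 ≤ form u v := by
  have hu := u.sheet hκ.le
  have hv := v.sheet hκ.le
  have h : (u.t * v.t) ^ 2 - (1 - κ * (u.a * v.a + u.b * v.b)) ^ 2
      = (-κ) * ((u.a - v.a) ^ 2 + (u.b - v.b) ^ 2) + (κ * (u.a * v.b - u.b * v.a)) ^ 2 := by
    have h1 : u.t ^ 2 = 1 - κ * (u.a ^ 2 + u.b ^ 2) := by linarith [u.quadric]
    have h2 : v.t ^ 2 = 1 - κ * (v.a ^ 2 + v.b ^ 2) := by linarith [v.quadric]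
    rw [mul_pow, h1, h2]
    ring
  have h3 : 0 ≤ (-κ) * ((u.a - v.a) ^ 2 + (u.b - v.b) ^ 2) :=
    mul_nonneg (by linarith) (by positivity)
  have h4 : 1 - κ * (u.a * v.a + u.b * v.b) ≤ u.t * v.t :=
    le_of_sq_le_sq (by nlinarith [sq_nonneg (κ * (u.a * v.b - u.b * v.a))]) (by positivity)
  unfold form
  linarith

theorem modelDist_self {κ : ℝ} (u : ModelPlane κ) : modelDist u u = 0 := by
  simp [modelDist, form_self]

theorem modelDist_comm {κ : ℝ} (u v : ModelPlane κ) : modelDist u v = modelDist v u := by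
  unfold modelDist
  rw [form_comm u v, show (u.a - v.a) ^ 2 + (u.b - v.b) ^ 2
    = (v.a - u.a) ^ 2 + (v.b - u.b) ^ 2 by ring]

theorem modelDist_triangle {κ : ℝ} (u v w : ModelPlane κ) :
    modelDist u w ≤ modelDist u v + modelDist v w := by
  have hg := form_gram u v w
  unfold modelDist
  split_ifs with h1 h2
  · rw [← add_div]
    refine div_le_div_of_nonneg_right ?_ (Real.sqrt_nonneg _)
    have hA := abs_le.1 (sq_le_one_iff_abs_le_one _ |>.1 (form_sq_le_one h1 u v))
    have hC := abs_le.1 (sq_le_one_iff_abs_le_one _ |>.1 (form_sq_le_one h1 v w))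
    by_cases hπ : Real.pi ≤ Real.arccos (form u v) + Real.arccos (form v w)
    · exact (Real.arccos_le_pi _).trans hπ
    have h0 : 0 ≤ Real.arccos (form u v) + Real.arccos (form v w) :=
      add_nonneg (Real.arccos_nonneg _) (Real.arccos_nonneg _)
    rw [← Real.arccos_cos h0 (le_of_not_ge hπ)]
    refine Real.arccos_le_arccos ?_
    rw [Real.cos_add, Real.cos_arccos hA.1 hA.2, Real.cos_arccos hC.1 hC.2, Real.sin_arccos,
      Real.sin_arccos, ← Real.sqrt_mul (by nlinarith)]
    have := Real.abs_le_sqrt hg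
    linarith [(abs_le.1 this).1]
  · rw [← add_div]
    refine div_le_div_of_nonneg_right ?_ (Real.sqrt_nonneg _)
    have hA := one_le_form h2 u v
    have hC := one_le_form h2 v w
    have hD := one_le_form h2 u w
    rw [← Real.arcosh_cosh (add_nonneg (Real.arcosh_nonneg hA) (Real.arcosh_nonneg hC)),
      Real.arcosh_le_arcosh (by linarith) (Real.cosh_pos _), Real.cosh_add,
      Real.cosh_arcosh hA, Real.cosh_arcosh hC, Real.sinh_arcosh hA, Real.sinh_arcosh hC,
      ← Real.sqrt_mul (by nlinarith)]
    have := Real.abs_le_sqrt (hg.trans_eq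
      (show _ = (form u v ^ 2 - 1) * (form v w ^ 2 - 1) by ring))
    linarith [(abs_le.1 this).2]
  · have h := dist_triangle !₂[u.a, u.b] !₂[v.a, v.b] !₂[w.a, w.b]
    simpa [EuclideanSpace.dist_eq, Real.dist_eq, sq_abs] using h

theorem eq_of_modelDist_eq_zero {κ : ℝ} {u v : ModelPlane κ} (h : modelDist u v = 0) :
    u = v := by
  unfold modelDist at h
  split_ifs at h with h1 h2
  · have hs : √κ ≠ 0 := (Real.sqrt_pos.2 h1).ne'
    have hB : 1 ≤ form u v := by
      simpa [hs, Real.arccos_eq_zero] using h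
    have hsum : (u.t - v.t) ^ 2 + κ * ((u.a - v.a) ^ 2 + (u.b - v.b) ^ 2) ≤ 0 := by
      have h3 := u.quadric
      have h4 := v.quadric
      unfold form at hB
      linarith
    have h5 : 0 ≤ κ * ((u.a - v.a) ^ 2 + (u.b - v.b) ^ 2) := by positivity
    have h6 : (u.a - v.a) ^ 2 + (u.b - v.b) ^ 2 ≤ 0 := by
      by_contra! h7
      nlinarith [mul_pos h1 h7, sq_nonneg (u.t - v.t)]
    ext
    · nlinarith [sq_nonneg (u.t - v.t)]
    · nlinarith [sq_nonneg (u.a - v.a), sq_nonneg (u.b - v.b)]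
    · nlinarith [sq_nonneg (u.a - v.a), sq_nonneg (u.b - v.b)]
  · have hs : √(-κ) ≠ 0 := (Real.sqrt_pos.2 (by linarith)).ne'
    have hB : form u v = 1 := by
      simpa [hs, Real.arcosh_eq_zero_iff (one_le_form h2 u v)] using h
    have h3 := u.quadric
    have h4 := v.quadric
    have hu := u.sheet h2.le
    have hv := v.sheet h2.le
    have e : (1 - κ * (u.a * v.a + u.b * v.b)) ^ 2
        = (1 - κ * (u.a ^ 2 + u.b ^ 2)) * (1 - κ * (v.a ^ 2 + v.b ^ 2)) := by
      have e1 : 1 - κ * (u.a * v.a + u.b * v.b) = u.t * v.t := by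
        unfold form at hB
        linarith
      have e2 : 1 - κ * (u.a ^ 2 + u.b ^ 2) = u.t ^ 2 := by linarith
      have e3 : 1 - κ * (v.a ^ 2 + v.b ^ 2) = v.t ^ 2 := by linarith
      rw [e1, e2, e3]
      ring
    have h6 : (u.a - v.a) ^ 2 + (u.b - v.b) ^ 2 ≤ 0 := by
      by_contra! h7
      nlinarith [mul_pos (neg_pos.2 h2) h7, sq_nonneg (κ * (u.a * v.b - u.b * v.a))]
    have ha : u.a = v.a := by nlinarith [sq_nonneg (u.a - v.a), sq_nonneg (u.b - v.b)]
    have hb : u.b = v.b := by nlinarith [sq_nonneg (u.a - v.a), sq_nonneg (u.b - v.b)]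
    have ht : u.t ^ 2 = v.t ^ 2 := by
      rw [ha, hb] at h3
      linarith
    exact ModelPlane.ext ((sq_eq_sq₀ hu.le hv.le).1 ht) ha hb
  · have h0 : κ = 0 := le_antisymm (not_lt.1 h1) (not_lt.1 h2)
    subst h0
    have h6 : (u.a - v.a) ^ 2 + (u.b - v.b) ^ 2 ≤ 0 := Real.sqrt_eq_zero'.1 h
    have h3 := u.quadric
    have h4 := v.quadric
    have hu := u.sheet le_rfl
    have hv := v.sheet le_rfl
    ext
    · exact (sq_eq_sq₀ hu.le hv.le).1 (by linarith)
    · nlinarith [sq_nonneg (u.a - v.a), sq_nonneg (u.b - v.b)]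
    · nlinarith [sq_nonneg (u.a - v.a), sq_nonneg (u.b - v.b)]

noncomputable instance instMetricSpace (κ : ℝ) : MetricSpace (ModelPlane κ) where
  dist := modelDist
  dist_self := modelDist_self
  dist_comm := modelDist_comm
  dist_triangle := modelDist_triangle
  eq_of_dist_eq_zero := eq_of_modelDist_eq_zero

end ModelPlane

/-- The diameter `D_κ` of the model plane: `π / √κ` if `κ > 0`, and `∞` if `κ ≤ 0`. -/
noncomputable def modelDiam (κ : ℝ) : EReal :=
  if 0 < κ then ((Real.pi / √κ : ℝ) : EReal) else ⊤

/-- `S` is a geodesic segment with endpoints `x` and `y`: the image of an isometric embedding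
`γ` of the interval `[0, d(x, y)]` with `γ 0 = x` and `γ (d(x, y)) = y`. -/
def IsGeodesicSegment {X : Type*} [MetricSpace X] (x y : X) (S : Set X) : Prop :=
  ∃ γ : ℝ → X,
    (∀ s ∈ Set.Icc 0 (dist x y), ∀ r ∈ Set.Icc 0 (dist x y), dist (γ s) (γ r) = |s - r|) ∧
      γ 0 = x ∧ γ (dist x y) = y ∧ S = γ '' Set.Icc 0 (dist x y)

/-- The segment `[x, y]`: the union of all geodesic segments with endpoints `x` and `y`, which is
the geodesic segment with these endpoints whenever there is exactly one
(in `ModelPlane κ`: whenever `d(x, y) < D_κ`). -/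
def geodesicSegment {X : Type*} [MetricSpace X] (x y : X) : Set X :=
  ⋃₀ {S | IsGeodesicSegment x y S}

/-! Regard the model plane as a quadric in `ℝ³`. The crossing point `p` of the diagonals is a
nonnegative combination both of `x'`, `z'` and of `y'`, `w'`
(`exists_combination_of_dist_add_dist`). Transplant the coefficients: `P = α x + γ z` and `Q = β y +
δ w`.

For `κ ≠ 0`, the pairing of `P` with `Q` involves only the four sides, so it is that of `p` with
itself, namely 1. The longer diagonal `xz` gives `κ (1 - ⟨P, P⟩) ≥ 0`; if `yw` were longer than
`y'w'`, the same would hold for `Q`. The equality case of Cauchy-Schwarz (`eq_of_polar_eq_one`) then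
forces `P = Q`, and pairing with `y` and `w` forces `β = δ = 0`, which is absurd.

For `κ = 0` the form does not see distances; the square of the Euclidean distance from `P` to `Q`
plays its role, and Stewart's theorem replaces the final pairing. -/

namespace ModelPlane

/-! ### The ambient bilinear form -/

variable {κ : ℝ}

/-- The symmetric bilinear form on `ℝ³` whose restriction to the model plane is `form`. -/
def polar (κ : ℝ) (u v : ℝ × ℝ × ℝ) : ℝ := u.1 * v.1 + κ * (u.2.1 * v.2.1 + u.2.2 * v.2.2)

/-- The inclusion of the model plane in `ℝ³`. -/
def toVec (u : ModelPlane κ) : ℝ × ℝ × ℝ := (u.t, u.a, u.b)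

theorem polar_toVec (u v : ModelPlane κ) : polar κ u.toVec v.toVec = form u v := rfl

theorem polar_comm (u v : ℝ × ℝ × ℝ) : polar κ u v = polar κ v u := by
  simp only [polar]
  ring

theorem polar_add_left (u v w : ℝ × ℝ × ℝ) :
    polar κ (u + v) w = polar κ u w + polar κ v w := by
  simp only [polar, Prod.fst_add, Prod.snd_add]
  ring

theorem polar_smul_left (c : ℝ) (u w : ℝ × ℝ × ℝ) : polar κ (c • u) w = c * polar κ u w := by
  simp only [polar, Prod.smul_fst, Prod.smul_snd, smul_eq_mul]
  ring

theorem polar_sub_left (u v w : ℝ × ℝ × ℝ) :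
    polar κ (u - v) w = polar κ u w - polar κ v w := by
  simp only [polar, Prod.fst_sub, Prod.snd_sub]
  ring

theorem polar_add_right (u v w : ℝ × ℝ × ℝ) :
    polar κ w (u + v) = polar κ w u + polar κ w v := by
  simp only [polar_comm w, polar_add_left]

theorem polar_smul_right (c : ℝ) (u w : ℝ × ℝ × ℝ) : polar κ w (c • u) = c * polar κ w u := by
  simp only [polar_comm w, polar_smul_left]

theorem polar_sub_right (u v w : ℝ × ℝ × ℝ) :
    polar κ w (u - v) = polar κ w u - polar κ w v := by
  simp only [polar_comm w, polar_sub_left]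

/-! ### Definiteness and the equality case of Cauchy-Schwarz -/

theorem eq_zero_of_polar_self_nonpos (hκ : 0 < κ) {v : ℝ × ℝ × ℝ} (h : polar κ v v ≤ 0) :
    v = 0 := by
  obtain ⟨t, a, b⟩ := v
  simp only [polar] at h
  have h1 : 0 ≤ κ * (a * a + b * b) := mul_nonneg hκ.le (by nlinarith [mul_self_nonneg a])
  have ht : t * t = 0 := le_antisymm (by linarith) (mul_self_nonneg t)
  have hab : a * a + b * b = 0 :=
    (mul_eq_zero.1 (le_antisymm (by linarith [mul_self_nonneg t]) h1)).resolve_left hκ.ne'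
  have ha : a * a = 0 := by linarith [mul_self_nonneg a, mul_self_nonneg b]
  have hb : b * b = 0 := by linarith [mul_self_nonneg a, mul_self_nonneg b]
  simp [mul_self_eq_zero.1 ht, mul_self_eq_zero.1 ha, mul_self_eq_zero.1 hb]

/-- For `κ < 0`, the form is negative definite on the orthogonal complement of a timelike
vector. -/
theorem eq_zero_of_polar_orthogonal (hκ : κ < 0) {p v : ℝ × ℝ × ℝ} (hp : 0 < polar κ p p)
    (hpv : polar κ p v = 0) (h : 0 ≤ polar κ v v) : v = 0 := by
  obtain ⟨t, a, b⟩ := v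
  obtain ⟨s, c, d⟩ := p
  simp only [polar] at h hp hpv
  have hs : 0 < s * s := by
    nlinarith [mul_nonneg (neg_nonneg.2 hκ.le) (add_nonneg (mul_self_nonneg c) (mul_self_nonneg d))]
  -- Orthogonality replaces `s t` by `-κ (c a + d b)`; Lagrange's identity then makes the right-hand
  -- side visibly nonpositive.
  have key : s * s * (t * t + κ * (a * a + b * b))
      = κ * ((s * s + κ * (c * c + d * d)) * (a * a + b * b)) - (κ * (c * b - d * a)) ^ 2 := by
    linear_combination (s * t - κ * (c * a + d * b)) * hpv
  have h1 := mul_nonneg hs.le h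
  have h2 : 0 ≤ (s * s + κ * (c * c + d * d)) * (a * a + b * b) :=
    mul_nonneg hp.le (add_nonneg (mul_self_nonneg a) (mul_self_nonneg b))
  have h3 : κ * ((s * s + κ * (c * c + d * d)) * (a * a + b * b)) = 0 :=
    le_antisymm (mul_nonpos_of_nonpos_of_nonneg hκ.le h2)
      (by linarith [sq_nonneg (κ * (c * b - d * a))])
  have hab : a * a + b * b = 0 :=
    ((mul_eq_zero.1 ((mul_eq_zero.1 h3).resolve_left hκ.ne)).resolve_left hp.ne')
  have ha : a = 0 := mul_self_eq_zero.1 (by linarith [mul_self_nonneg a, mul_self_nonneg b])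
  have hb : b = 0 := mul_self_eq_zero.1 (by linarith [mul_self_nonneg a, mul_self_nonneg b])
  subst ha hb
  have hst : s * t = 0 := by linarith
  have ht : t = 0 := (mul_eq_zero.1 hst).resolve_left fun h0 => by simp [h0] at hs
  simp [ht]

/-- The equality case of the Cauchy-Schwarz inequality (reversed when `κ < 0`). -/
theorem eq_of_polar_eq_one (hκ : κ ≠ 0) {p q : ℝ × ℝ × ℝ} (hpq : polar κ p q = 1)
    (hp : 0 ≤ κ * (1 - polar κ p p)) (hq : 0 ≤ κ * (1 - polar κ q q)) : p = q := by
  rcases lt_or_gt_of_ne hκ with h | h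
  · have hp1 : 1 ≤ polar κ p p := by linarith [nonpos_of_mul_nonneg_right hp h]
    have hq1 : 1 ≤ polar κ q q := by linarith [nonpos_of_mul_nonneg_right hq h]
    -- This vector is orthogonal to `p`, and its square is `⟨p, p⟩ (⟨p, p⟩ ⟨q, q⟩ - 1) ≥ 0`.
    have hv : polar κ p p • q - p = 0 := by
      refine eq_zero_of_polar_orthogonal h (p := p) (by linarith) ?_ ?_
      · rw [polar_sub_right, polar_smul_right, hpq]
        ring
      · simp only [polar_sub_right, polar_sub_left, polar_smul_right, polar_smul_left,
          polar_comm q p, hpq]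
        nlinarith [mul_nonneg (sub_nonneg.2 hp1) (sub_nonneg.2 hq1)]
    have h1 : polar κ (polar κ p p • q - p) q = 0 := by rw [hv]; simp [polar]
    rw [polar_sub_left, polar_smul_left, hpq] at h1
    have h2 : polar κ p p = 1 := by nlinarith
    rw [h2, one_smul, sub_eq_zero] at hv
    exact hv.symm
  · refine sub_eq_zero.1 (eq_zero_of_polar_self_nonpos h ?_)
    have hp1 := nonneg_of_mul_nonneg_right hp h
    have hq1 := nonneg_of_mul_nonneg_right hq h
    simp only [polar_sub_right, polar_sub_left, polar_comm q p, hpq]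
    linarith

/-! ### Distance in terms of the form -/

theorem dist_def (u v : ModelPlane κ) : dist u v = modelDist u v := rfl

theorem dist_of_pos (hκ : 0 < κ) (u v : ModelPlane κ) :
    dist u v = Real.arccos (form u v) / √κ := by
  rw [dist_def, modelDist, if_pos hκ]

theorem dist_of_neg (hκ : κ < 0) (u v : ModelPlane κ) :
    dist u v = Real.arcosh (form u v) / √(-κ) := by
  rw [dist_def, modelDist, if_neg hκ.not_gt, if_pos hκ]

theorem dist_sq_of_zero (u v : ModelPlane 0) :
    dist u v ^ 2 = (u.a - v.a) ^ 2 + (u.b - v.b) ^ 2 := by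
  rw [dist_def, modelDist, if_neg (lt_irrefl _), if_neg (lt_irrefl _), Real.sq_sqrt (by positivity)]

theorem form_eq_cos (hκ : 0 < κ) (u v : ModelPlane κ) : form u v = Real.cos (√κ * dist u v) := by
  have h := abs_le.1 (sq_le_one_iff_abs_le_one _ |>.1 (form_sq_le_one hκ u v))
  rw [dist_of_pos hκ, mul_div_cancel₀ _ (Real.sqrt_pos.2 hκ).ne', Real.cos_arccos h.1 h.2]

theorem form_eq_cosh (hκ : κ < 0) (u v : ModelPlane κ) :
    form u v = Real.cosh (√(-κ) * dist u v) := by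
  rw [dist_of_neg hκ, mul_div_cancel₀ _ (Real.sqrt_pos.2 (neg_pos.2 hκ)).ne',
    Real.cosh_arcosh (one_le_form hκ u v)]

/-- Cosine decreases on `[0, π]` and hyperbolic cosine increases on `[0, ∞)`; the factor `κ` absorbs
this change of sign, so that both curvatures can be treated together. -/
theorem mul_form_le_mul_form_iff (hκ : κ ≠ 0) (u v u' v' : ModelPlane κ) :
    κ * form u v ≤ κ * form u' v' ↔ dist u' v' ≤ dist u v := by
  rcases lt_or_gt_of_ne hκ with h | h
  · have hs := Real.sqrt_pos.2 (neg_pos.2 h)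
    rw [mul_le_mul_left_of_neg h, form_eq_cosh h, form_eq_cosh h, Real.cosh_le_cosh,
      abs_of_nonneg (by positivity), abs_of_nonneg (by positivity), mul_le_mul_iff_right₀ hs]
  · have hs := Real.sqrt_pos.2 h
    have hle (u v : ModelPlane κ) : √κ * dist u v ≤ Real.pi := by
      rw [dist_of_pos h, mul_div_cancel₀ _ hs.ne']
      exact Real.arccos_le_pi _
    rw [mul_le_mul_iff_right₀ h, form_eq_cos h, form_eq_cos h,
      Real.strictAntiOn_cos.le_iff_ge ⟨by positivity, hle _ _⟩ ⟨by positivity, hle _ _⟩,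
      mul_le_mul_iff_right₀ hs]

theorem form_eq_of_dist_eq (hκ : κ ≠ 0) {u v u' v' : ModelPlane κ} (h : dist u v = dist u' v') :
    form u v = form u' v' :=
  mul_left_cancel₀ hκ (le_antisymm ((mul_form_le_mul_form_iff hκ ..).2 h.ge)
    ((mul_form_le_mul_form_iff hκ ..).2 h.le))

/-! ### Points of a segment as nonnegative combinations -/

theorem exists_combination_of_smul {x z p : ModelPlane κ} {f g h : ℝ} (hf : 0 ≤ f) (hg : 0 ≤ g)
    (hh : 0 < h) (e : f • x.toVec + g • z.toVec - h • p.toVec = 0) :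
    ∃ α γ : ℝ, 0 ≤ α ∧ 0 ≤ γ ∧ p.toVec = α • x.toVec + γ • z.toVec := by
  refine ⟨f / h, g / h, by positivity, by positivity, ?_⟩
  have e' := sub_eq_zero.1 e
  calc p.toVec = h⁻¹ • (h • p.toVec) := by rw [smul_smul, inv_mul_cancel₀ hh.ne', one_smul]
    _ = _ := by rw [← e', smul_add, smul_smul, smul_smul, div_eq_inv_mul, div_eq_inv_mul]

/-- A point between `x` and `z` is a nonnegative linear combination of `x` and `z`. -/
theorem exists_combination_of_dist_add_dist {x z p : ModelPlane κ}
    (h : dist x p + dist p z = dist x z) (hD : 0 < κ → √κ * dist x z < Real.pi) :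
    ∃ α γ : ℝ, 0 ≤ α ∧ 0 ≤ γ ∧ p.toVec = α • x.toVec + γ • z.toVec := by
  -- When `x = z`, the coefficient of `p` used below vanishes and cannot be divided by.
  rcases (dist_nonneg (x := x) (y := z)).eq_or_lt with h0 | h0
  · have hx : x = p := dist_le_zero.1 (by linarith [dist_nonneg (x := p) (y := z)])
    exact ⟨1, 0, by simp, by simp, by simp [hx]⟩
  have hs0 : 0 ≤ dist x p := dist_nonneg
  have hr0 : 0 ≤ dist p z := dist_nonneg
  rcases lt_trichotomy κ 0 with hκ | rfl | hκ
  · have hk := Real.sqrt_pos.2 (neg_pos.2 hκ)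
    have exp := form_eq_cosh hκ x p
    have epz := form_eq_cosh hκ p z
    have exz := form_eq_cosh hκ x z
    rw [← h, mul_add] at exz
    have hs : 0 ≤ √(-κ) * dist x p := by positivity
    have hr : 0 ≤ √(-κ) * dist p z := by positivity
    have hsr : 0 < √(-κ) * dist x p + √(-κ) * dist p z := by rw [← mul_add, h]; positivity
    generalize √(-κ) * dist x p = s at *
    generalize √(-κ) * dist p z = r at *
    -- The relation is `sinh r • x + sinh s • z = sinh (s + r) • p`. The difference of the two sides
    -- is orthogonal to `p` and null, hence zero.
    refine exists_combination_of_smul (Real.sinh_nonneg_iff.2 hr) (Real.sinh_nonneg_iff.2 hs)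
      (Real.sinh_pos_iff.2 hsr) ?_
    refine eq_zero_of_polar_orthogonal hκ (p := p.toVec) ?_ ?_ (le_of_eq ?_)
    · simp [polar_toVec, form_self]
    · simp only [polar_sub_right, polar_add_right, polar_smul_right, polar_toVec, form_self,
        form_comm p x, exp, epz, Real.sinh_add]
      ring
    · simp only [polar_sub_right, polar_add_right, polar_smul_right, polar_sub_left,
        polar_add_left, polar_smul_left, polar_toVec, form_self, form_comm p x, form_comm z p,
        form_comm z x, exp, epz, exz, Real.sinh_add, Real.cosh_add]
      have h1 := Real.cosh_sq s
      have h2 := Real.cosh_sq r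
      grind
  · have exp := dist_sq_of_zero x p
    have epz := dist_sq_of_zero p z
    have exz := dist_sq_of_zero x z
    rw [← h] at exz h0
    have ht (u : ModelPlane 0) : u.t = 1 := by
      have h1 := u.quadric
      have h2 := u.sheet le_rfl
      nlinarith
    refine exists_combination_of_smul hr0 hs0 h0 ?_
    generalize dist x p = s at *
    generalize dist p z = r at *
    -- Expanding gives a combination of the squared lengths `s ^ 2`, `r ^ 2` and `(s + r) ^ 2` that
    -- cancels.
    have key : (r * x.a + s * z.a - (s + r) * p.a) ^ 2
        + (r * x.b + s * z.b - (s + r) * p.b) ^ 2 = 0 := by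
      grind
    have ka : r * x.a + s * z.a - (s + r) * p.a = 0 := by
      nlinarith [sq_nonneg (r * x.a + s * z.a - (s + r) * p.a),
        sq_nonneg (r * x.b + s * z.b - (s + r) * p.b)]
    have kb : r * x.b + s * z.b - (s + r) * p.b = 0 := by
      nlinarith [sq_nonneg (r * x.a + s * z.a - (s + r) * p.a),
        sq_nonneg (r * x.b + s * z.b - (s + r) * p.b)]
    simp only [toVec, Prod.smul_mk, smul_eq_mul, Prod.mk_add_mk, Prod.mk_sub_mk, ka, kb, ht]
    simp [add_comm]
  · have hk := Real.sqrt_pos.2 hκ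
    have exp := form_eq_cos hκ x p
    have epz := form_eq_cos hκ p z
    have exz := form_eq_cos hκ x z
    have hD' := hD hκ
    rw [← h, mul_add] at exz hD'
    have hs : 0 ≤ √κ * dist x p := by positivity
    have hr : 0 ≤ √κ * dist p z := by positivity
    have hsr : 0 < √κ * dist x p + √κ * dist p z := by rw [← mul_add, h]; positivity
    generalize √κ * dist x p = s at *
    generalize √κ * dist p z = r at *
    -- The bound `s + r < π` makes `sin (s + r)` positive; as the form is positive definite, it
    -- suffices that the difference is null.
    refine exists_combination_of_smul (Real.sin_nonneg_of_nonneg_of_le_pi hr (by linarith))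
      (Real.sin_nonneg_of_nonneg_of_le_pi hs (by linarith)) (Real.sin_pos_of_pos_of_lt_pi hsr hD') ?_
    refine eq_zero_of_polar_self_nonpos hκ (le_of_eq ?_)
    simp only [polar_sub_right, polar_add_right, polar_smul_right, polar_sub_left,
      polar_add_left, polar_smul_left, polar_toVec, form_self, form_comm p x, form_comm z p,
      form_comm z x, exp, epz, exz, Real.sin_add, Real.cos_add]
    have h1 := Real.sin_sq_add_cos_sq s
    have h2 := Real.sin_sq_add_cos_sq r
    grind

/-! ### Comparison of the diagonals -/

theorem dist_le_of_combination_of_ne_zero (hκ : κ ≠ 0) {x y z w x' y' z' w' p : ModelPlane κ}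
    (hxy : dist x y = dist x' y') (hyz : dist y z = dist y' z')
    (hzw : dist z w = dist z' w') (hwx : dist w x = dist w' x')
    (hxz : dist x' z' ≤ dist x z) {α γ β δ : ℝ} (hα : 0 ≤ α) (hγ : 0 ≤ γ) (hβ : 0 ≤ β)
    (hδ : 0 ≤ δ) (hp : p.toVec = α • x'.toVec + γ • z'.toVec)
    (hq : p.toVec = β • y'.toVec + δ • w'.toVec) : dist y w ≤ dist y' w' := by
  by_contra! hlt
  have exy := form_eq_of_dist_eq hκ hxy
  have eyz := form_eq_of_dist_eq hκ hyz
  have ezw := form_eq_of_dist_eq hκ hzw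
  have ewx := form_eq_of_dist_eq hκ hwx
  have exz := (mul_form_le_mul_form_iff hκ ..).2 hxz
  have eyw := (mul_form_le_mul_form_iff hκ ..).2 hlt.le
  have hne : form y w ≠ form y' w' := fun h =>
    hlt.not_ge ((mul_form_le_mul_form_iff hκ ..).1 (h ▸ le_rfl))
  have hpp : polar κ p.toVec p.toVec = 1 := form_self p
  have hpq : polar κ (α • x'.toVec + γ • z'.toVec) (β • y'.toVec + δ • w'.toVec) = 1 := by
    rw [← hp, ← hq, hpp]
  have hp1 := hpp
  have hq1 := hpp
  rw [hp] at hp1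
  rw [hq] at hq1
  have hqy : polar κ (α • x'.toVec + γ • z'.toVec) y'.toVec
      = polar κ (β • y'.toVec + δ • w'.toVec) y'.toVec := by rw [← hp, ← hq]
  have hqw : polar κ (α • x'.toVec + γ • z'.toVec) w'.toVec
      = polar κ (β • y'.toVec + δ • w'.toVec) w'.toVec := by rw [← hp, ← hq]
  simp only [polar_add_right, polar_smul_right, polar_add_left, polar_smul_left, polar_toVec,
    form_self, form_comm z' x', form_comm w' y', form_comm x' w', form_comm z' y']
    at hpq hp1 hq1 hqy hqw
  have heq : α • x.toVec + γ • z.toVec = β • y.toVec + δ • w.toVec := by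
    refine eq_of_polar_eq_one hκ ?_ ?_ ?_
    · simp only [polar_add_right, polar_smul_right, polar_add_left, polar_smul_left, polar_toVec,
        form_comm x w, form_comm z y, exy, eyz, ezw, ewx]
      exact hpq
    · simp only [polar_add_right, polar_smul_right, polar_add_left, polar_smul_left, polar_toVec,
        form_self, form_comm z x]
      linear_combination 2 * mul_nonneg (mul_nonneg hα hγ) (sub_nonneg.2 exz) + κ * hp1
    · simp only [polar_add_right, polar_smul_right, polar_add_left, polar_smul_left, polar_toVec,
        form_self, form_comm w y]
      linear_combination 2 * mul_nonneg (mul_nonneg hβ hδ) (sub_nonneg.2 eyw) + κ * hq1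
  -- Compared with `hqy` and `hqw`, these differ only in the term containing the diagonal `yw`.
  have hy := congrArg (polar κ · y.toVec) heq
  have hw := congrArg (polar κ · w.toVec) heq
  simp only [polar_add_left, polar_smul_left, polar_toVec, form_self, form_comm w y,
    form_comm x w, form_comm z y, exy, eyz, ezw, ewx] at hy hw
  have hδ0 : δ = 0 :=
    (mul_eq_zero.1 (show δ * (form y w - form y' w') = 0 by linarith)).resolve_right
      (sub_ne_zero.2 hne)
  have hβ0 : β = 0 :=
    (mul_eq_zero.1 (show β * (form y w - form y' w') = 0 by linarith)).resolve_right
      (sub_ne_zero.2 hne)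
  simp [hδ0, hβ0] at hq1

/-- For `κ = 0` the form is constantly 1 on the plane, so squared distances are used instead. The
coordinate `t = 1` turns the linear combinations into affine ones. -/
theorem dist_le_of_combination_of_zero {x y z w x' y' z' w' p : ModelPlane 0}
    (hxy : dist x y = dist x' y') (hyz : dist y z = dist y' z')
    (hzw : dist z w = dist z' w') (hwx : dist w x = dist w' x')
    (hxz : dist x' z' ≤ dist x z) {α γ β δ : ℝ} (hα : 0 ≤ α) (hγ : 0 ≤ γ) (hβ : 0 ≤ β)
    (hδ : 0 ≤ δ) (hp : p.toVec = α • x'.toVec + γ • z'.toVec)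
    (hq : p.toVec = β • y'.toVec + δ • w'.toVec) : dist y w ≤ dist y' w' := by
  by_contra! hlt
  have ht (u : ModelPlane 0) : u.t = 1 := by
    have h1 := u.quadric
    have h2 := u.sheet le_rfl
    nlinarith
  have exy := congrArg (· ^ 2) hxy
  have eyz := congrArg (· ^ 2) hyz
  have ezw := congrArg (· ^ 2) hzw
  have ewx := congrArg (· ^ 2) hwx
  have exz := pow_le_pow_left₀ dist_nonneg hxz 2
  have eyw := pow_lt_pow_left₀ hlt dist_nonneg two_ne_zero
  simp only [dist_sq_of_zero] at exy eyz ezw ewx exz eyw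
  simp only [toVec, Prod.smul_mk, smul_eq_mul, Prod.mk_add_mk, Prod.mk.injEq, ht, mul_one]
    at hp hq
  obtain ⟨hp1, hpa, hpb⟩ := hp
  obtain ⟨hq1, hqa, hqb⟩ := hq
  obtain rfl : γ = 1 - α := by linarith
  obtain rfl : δ = 1 - β := by linarith
  have h1 := mul_nonneg (mul_nonneg hα hγ) (sub_nonneg.2 exz)
  have h2 := mul_nonneg (mul_nonneg hβ hδ) (sub_nonneg.2 eyw.le)
  have key (x y z w : ModelPlane 0) :
      (α * x.a + (1 - α) * z.a - (β * y.a + (1 - β) * w.a)) ^ 2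
        + (α * x.b + (1 - α) * z.b - (β * y.b + (1 - β) * w.b)) ^ 2
      = α * β * ((x.a - y.a) ^ 2 + (x.b - y.b) ^ 2)
        + (1 - α) * β * ((y.a - z.a) ^ 2 + (y.b - z.b) ^ 2)
        + (1 - α) * (1 - β) * ((z.a - w.a) ^ 2 + (z.b - w.b) ^ 2)
        + α * (1 - β) * ((w.a - x.a) ^ 2 + (w.b - x.b) ^ 2)
        - α * (1 - α) * ((x.a - z.a) ^ 2 + (x.b - z.b) ^ 2)
        - β * (1 - β) * ((y.a - w.a) ^ 2 + (y.b - w.b) ^ 2) := by ring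
  have k := key x y z w
  have k' := key x' y' z' w'
  rw [← hpa, ← hpb, ← hqa, ← hqb] at k'
  rw [exy, eyz, ezw, ewx] at k
  have hs : (α * x.a + (1 - α) * z.a - (β * y.a + (1 - β) * w.a)) ^ 2
        + (α * x.b + (1 - α) * z.b - (β * y.b + (1 - β) * w.b)) ^ 2
      = - (α * (1 - α) * ((x.a - z.a) ^ 2 + (x.b - z.b) ^ 2
          - ((x'.a - z'.a) ^ 2 + (x'.b - z'.b) ^ 2)))
        - β * (1 - β) * ((y.a - w.a) ^ 2 + (y.b - w.b) ^ 2
          - ((y'.a - w'.a) ^ 2 + (y'.b - w'.b) ^ 2)) := by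
    linear_combination k - k'
  have ha := sq_nonneg (α * x.a + (1 - α) * z.a - (β * y.a + (1 - β) * w.a))
  have hb := sq_nonneg (α * x.b + (1 - α) * z.b - (β * y.b + (1 - β) * w.b))
  -- In `hs` a sum of two squares equals minus two nonnegative terms, so everything vanishes.
  have hαγ := le_antisymm (by linarith only [hs, h1, h2, ha, hb]) h1
  have ea := sub_eq_zero.1 (pow_eq_zero_iff two_ne_zero |>.1
    (le_antisymm (by linarith only [hs, h1, h2, ha, hb]) ha))
  have eb := sub_eq_zero.1 (pow_eq_zero_iff two_ne_zero |>.1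
    (le_antisymm (by linarith only [hs, h1, h2, ha, hb]) hb))
  have stewart (x z v : ModelPlane 0) :
      (α * x.a + (1 - α) * z.a - v.a) ^ 2 + (α * x.b + (1 - α) * z.b - v.b) ^ 2
      = α * ((x.a - v.a) ^ 2 + (x.b - v.b) ^ 2) + (1 - α) * ((z.a - v.a) ^ 2 + (z.b - v.b) ^ 2)
        - α * (1 - α) * ((x.a - z.a) ^ 2 + (x.b - z.b) ^ 2) := by ring
  have sy := stewart x z y
  have sy' := stewart x' z' y'
  have sw := stewart x z w
  have sw' := stewart x' z' w'
  rw [← hpa, ← hpb, hqa, hqb] at sy' sw'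
  rw [ea, eb] at sy sw
  have hne : ((y.a - w.a) ^ 2 + (y.b - w.b) ^ 2
      - ((y'.a - w'.a) ^ 2 + (y'.b - w'.b) ^ 2)) ≠ 0 := (sub_pos.2 eyw).ne'
  -- The point `β y + (1 - β) w` lies at distance `(1 - β) d(y, w)` from `y`. Stewart's theorem
  -- expresses the square of this distance through the sides and the `xz` term, which agree in both
  -- configurations.
  have hδ0 : (1 - β) ^ 2 = 0 := by
    by_contra h0
    refine mul_ne_zero h0 hne ?_
    linear_combination sy - sy' + α * exy + (1 - α) * eyz - hαγ
  have hβ0 : β ^ 2 = 0 := by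
    by_contra h0
    refine mul_ne_zero h0 hne ?_
    linear_combination sw - sw' + α * ewx + (1 - α) * ezw - hαγ
  linarith [pow_eq_zero_iff two_ne_zero |>.1 hδ0, pow_eq_zero_iff two_ne_zero |>.1 hβ0]

/-! ### Geodesic segments and the perimeter bound -/

theorem dist_add_dist_of_mem_geodesicSegment {X : Type*} [MetricSpace X] {x z p : X}
    (h : p ∈ geodesicSegment x z) : dist x p + dist p z = dist x z := by
  obtain ⟨_, ⟨γ, hγ, h0, h1, rfl⟩, s, hs, rfl⟩ := h
  have e0 := hγ 0 ⟨le_rfl, dist_nonneg⟩ s hs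
  have e1 := hγ s hs _ ⟨dist_nonneg, le_rfl⟩
  rw [h0, zero_sub, abs_neg, abs_of_nonneg hs.1] at e0
  rw [h1, abs_sub_comm, abs_of_nonneg (sub_nonneg.2 hs.2)] at e1
  rw [e0, e1]
  ring

/-- Meant for `r` the perimeter and `d` a diagonal: a diagonal cuts the quadrilateral into two
triangles, so twice its length is at most the perimeter. -/
theorem sqrt_mul_lt_pi (hκ : 0 < κ) {r d : ℝ} (h : (r : EReal) < 2 * modelDiam κ)
    (hd : 2 * d ≤ r) : √κ * d < Real.pi := by
  have e : (2 : EReal) * modelDiam κ = ((2 * (Real.pi / √κ) : ℝ) : EReal) := by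
    rw [modelDiam, if_pos hκ, EReal.coe_mul]
    rfl
  rw [e, EReal.coe_lt_coe_iff] at h
  have h1 : d < Real.pi / √κ := by linarith
  rw [lt_div_iff₀ (Real.sqrt_pos.2 hκ)] at h1
  linarith

end ModelPlane

open ModelPlane in
theorem mainTheorem10 (κ : ℝ) (x y z w x' y' z' w' : ModelPlane κ)
    (hperim : ((dist x' y' + dist y' z' + dist z' w' + dist w' x' : ℝ) : EReal)
      < 2 * modelDiam κ)
    (hxy : dist x y = dist x' y') (hyz : dist y z = dist y' z')
    (hzw : dist z w = dist z' w') (hwx : dist w x = dist w' x')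
    (hxz : dist x' z' ≤ dist x z)
    (hdiag : (geodesicSegment x' z' ∩ geodesicSegment y' w').Nonempty) :
    dist y w ≤ dist y' w' := by
  obtain ⟨p, hp, hq⟩ := hdiag
  obtain ⟨α, γ, hα, hγ, ep⟩ := exists_combination_of_dist_add_dist
    (dist_add_dist_of_mem_geodesicSegment hp) fun hκ => sqrt_mul_lt_pi hκ hperim (by
      linarith [dist_triangle x' y' z', dist_triangle x' w' z', dist_comm x' w', dist_comm w' z'])
  obtain ⟨β, δ, hβ, hδ, eq⟩ := exists_combination_of_dist_add_dist
    (dist_add_dist_of_mem_geodesicSegment hq) fun hκ => sqrt_mul_lt_pi hκ hperim (by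
      linarith [dist_triangle y' z' w', dist_triangle y' x' w', dist_comm x' w', dist_comm y' x'])
  rcases eq_or_ne κ 0 with rfl | hκ
  · exact dist_le_of_combination_of_zero hxy hyz hzw hwx hxz hα hγ hβ hδ ep eq
  · exact dist_le_of_combination_of_ne_zero hκ hxy hyz hzw hwx hxz hα hγ hβ hδ ep eq
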